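/- Let $n \ge 0$ and $p \ge 1$ be integers and let $\mu$ be a Borel probability measure on $\mathbb{R}^{n\times n}$ with bounded support. Write $\|\cdot\|$ for the Euclidean norm on vectors and for the maximal singular value on matrices, let $A, A_0, A_1, A_2, \dots$ be independent random matrices following $\mu$, and let $\Sigma_\mu$ be the stochastic switched linear system $x(k+1) = A_k x(k)$, $x(0) = x_0 \in \mathbb{R}^n$. Definitions. (a) The $L^p$-norm joint spectral radius of $\mu$ is $\rho_{p,\mu} = \lim_{k\to\infty} \left(E\|A_{k-1}\cdots A_1A_0\|^p\right)^{1/(pk)}$. (b) $\Sigma_\mu$ is $p$-th mean stable if there are $C > 0$ and $\gamma_0 \in [0,1)$ with $E\|x(k)\|^p \le C\gamma_0^{pk}\|x_0\|^p$ for all $x_0 \in \mathbb{R}^n$ and all $k \ge 0$. (c) A set $K \subset \mathbb{R}^m$ closed under multiplication by nonnegative numbers is a proper cone if it is closed, convex, has nonempty interior, and $x, -x \in K$ implies $x = 0$. A set of matrices leaves $K$ invariant if each of its elements maps $K$ into $K$. The dual cone is $K^* = \{f \in \mathbb{R}^m : f^\top x \ge 0 \text{ for all } x \in K\}$. (d)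 A norm $N$ on $\mathbb{R}^m$ is cone linear absolute if there is a proper cone $K \subset \mathbb{R}^m$ such that $N(x) = \inf\{N(v+w) : v, w \in K,\ x = v - w\}$ for every $x \in \mathbb{R}^m$, and there is $f \in K^*$ with $N(x) = f^\top x$ for every $x \in K$. (e) A function $V : \mathbb{R}^n \to \mathbb{R}$ is a stochastic Lyapunov function of degree $p$ for $\Sigma_\mu$ with growth rate $\gamma \in [0,1)$ if there are $C_1, C_2 > 0$ with $C_1\|x\|^p \le V(x) \le C_2\|x\|^p$ for all $x \in \mathbb{R}^n$, and, for all $x \in \mathbb{R}^n$, $V(Ax)$ is integrable with $E[V(Ax)] \le \gamma^p V(x)$. (f) $x^{\otimes p} \in \mathbb{R}^{n^p}$ is the $p$-th Kronecker power of $x \in \mathbb{R}^n$. Theorem. Suppose that $\Sigma_\mu$ is $p$-th mean stable and that $\operatorname{supp}\mu$ leaves a proper cone in $\mathbb{R}^n$ invariant. Then for every $\gamma \in (\rho_{p,\mu}, 1)$ there exists a cone linear absolute norm $N$ on $\mathbb{R}^{n^p}$ such that $V(x) = N(x^{\otimes p})$ is a stochastic Lyapunov function of degree $p$ for $\Sigma_\mu$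 with growth rate $\gamma$. -/

import Mathlib

open MeasureTheory Filter Topology Set
open scoped Matrix.Norms.L2Operator

namespace SwitchedLinear

/-- Real `n × n` matrices; `‖A‖` is the largest singular value of `A`. -/
abbrev Mat (n : ℕ) : Type := Matrix (Fin n) (Fin n) ℝ

/-- `ℝⁿ` with the Euclidean norm. -/
abbrev Vec (n : ℕ) : Type := EuclideanSpace ℝ (Fin n)

/-- The (entrywise) Borel σ-algebra on real matrices. -/
instance instMeasurableSpaceMat (n : ℕ) : MeasurableSpace (Mat n) :=
  inferInstanceAs (MeasurableSpace (Fin n → Fin n → ℝ))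

instance instBorelSpaceMat (n : ℕ) : BorelSpace (Mat n) :=
  inferInstanceAs (BorelSpace (Fin n → Fin n → ℝ))

noncomputable section

/-- The product `A x` of a matrix and a vector. -/
def act {n : ℕ} (A : Mat n) (x : Vec n) : Vec n := Matrix.toEuclideanLin A x

/-! ### Cones and norms -/

/-- A proper cone: closed under multiplication by nonnegative numbers, closed, convex,
solid and pointed. -/
structure IsProperCone {n : ℕ} (K : Set (Vec n)) : Prop where
  smul_mem : ∀ c : ℝ, 0 ≤ c → ∀ x ∈ K, c • x ∈ K
  isClosed : IsClosed K
  convex : Convex ℝ K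
  solid : (interior K).Nonempty
  pointed : ∀ x, x ∈ K → -x ∈ K → x = 0

/-- Every matrix of the set `M` maps `K` into `K`. -/
def LeavesInvariant {n : ℕ} (M : Set (Mat n)) (K : Set (Vec n)) : Prop :=
  ∀ A ∈ M, ∀ x ∈ K, act A x ∈ K

/-- The dual cone `K* = {f | fᵀ x ≥ 0 for every x ∈ K}`. -/
def dualCone {n : ℕ} (K : Set (Vec n)) : Set (Vec n) :=
  {f | ∀ x ∈ K, 0 ≤ inner ℝ f x}

/-- A seminorm is a norm if it vanishes only at `0`. -/
def IsNorm {n : ℕ} (N : Seminorm ℝ (Vec n)) : Prop := ∀ x, N x = 0 → x = 0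

/-- `N x` is the infimum of `N (v + w)` over `v, w ∈ K` with `x = v - w`, for every `x`. -/
def IsConeAbsolute {n : ℕ} (N : Seminorm ℝ (Vec n)) (K : Set (Vec n)) : Prop :=
  ∀ x, IsGLB {r : ℝ | ∃ v ∈ K, ∃ w ∈ K, x = v - w ∧ r = N (v + w)} (N x)

/-- On `K`, `N` coincides with some `f` in the dual cone. -/
def IsConeLinear {n : ℕ} (N : Seminorm ℝ (Vec n)) (K : Set (Vec n)) : Prop :=
  ∃ f ∈ dualCone K, ∀ x ∈ K, N x = inner ℝ f x

/-- A norm that is cone linear and cone absolute with respect to a common proper cone. -/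
def IsConeLinearAbsoluteNorm {n : ℕ} (N : Seminorm ℝ (Vec n)) : Prop :=
  IsNorm N ∧ ∃ K, IsProperCone K ∧ IsConeLinear N K ∧ IsConeAbsolute N K

/-! ### Kronecker powers -/

/-- The Kronecker power `x^{⊗p} ∈ ℝ^{n^p}`: its `i`-th entry is the product of the entries of `x`
at the `p` base-`n` digits of `i`. -/
def kronPow {n : ℕ} (p : ℕ) (x : Vec n) : Vec (n ^ p) :=
  WithLp.toLp 2 fun i => ∏ j : Fin p, x (finFunctionFinEquiv.symm i j)

/-- The recursion `x^{⊗(p+1)} = x^{⊗p} ⊗ x` for the Kronecker product with its usual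
(lexicographic) ordering of the entries. -/
theorem kronPow_succ {n : ℕ} (p : ℕ) (x : Vec n) (i : Fin (n ^ p)) (j : Fin n) :
    kronPow (p + 1) x (finProdFinEquiv (i, j) : Fin (n ^ p * n)) = kronPow p x i * x j := by
  have hn : 0 < n := j.pos
  set q : Fin (n ^ (p + 1)) := (finProdFinEquiv (i, j) : Fin (n ^ p * n)) with hq
  have hv : (q : ℕ) = (j : ℕ) + n * (i : ℕ) := rfl
  have h0 : finFunctionFinEquiv.symm q 0 = j := by
    apply Fin.ext
    rw [finFunctionFinEquiv_symm_apply_val, hv]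
    simp [Nat.mod_eq_of_lt j.isLt]
  have hs : ∀ b : Fin p, finFunctionFinEquiv.symm q b.succ = finFunctionFinEquiv.symm i b := by
    intro b
    apply Fin.ext
    rw [finFunctionFinEquiv_symm_apply_val, finFunctionFinEquiv_symm_apply_val, hv, Fin.val_succ,
      pow_succ', ← Nat.div_div_eq_div_mul, Nat.add_mul_div_left _ _ hn,
      Nat.div_eq_of_lt j.isLt, zero_add]
  simp only [kronPow]
  rw [Fin.prod_univ_succ, h0, mul_comm]
  simp only [hs]

/-! ### The stochastic switched linear system `x(k+1) = A_k x(k)`, `A_k ∼ μ` i.i.d. -/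

/-- The product `A_{k-1} ⋯ A_1 A_0` of the first `k` matrices of a sequence. -/
def matProd {n : ℕ} (A : ℕ → Mat n) : ℕ → Mat n
  | 0 => 1
  | k + 1 => A k * matProd A k

/-- The trajectory `x(0) = x₀`, `x(k+1) = A_k x(k)`. -/
def trajectory {n : ℕ} (A : ℕ → Mat n) (x₀ : Vec n) : ℕ → Vec n
  | 0 => x₀
  | k + 1 => act (A k) (trajectory A x₀ k)

/-- The law of a sequence `A_0, A_1, …` of independent random matrices, each following `μ`. -/
def iidLaw {n : ℕ} (μ : Measure (Mat n)) [IsProbabilityMeasure μ] : Measure (ℕ → Mat n) :=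
  Measure.infinitePi fun _ : ℕ => μ

/-- The `L^p`-norm joint spectral radius
`ρ_{p,μ} = lim_{k → ∞} (E ‖A_{k-1} ⋯ A_0‖^p)^{1/(pk)}`. -/
def pRadius {n : ℕ} (p : ℕ) (μ : Measure (Mat n)) [IsProbabilityMeasure μ] : ℝ :=
  limUnder atTop fun k : ℕ =>
    (∫ A, ‖matProd A k‖ ^ p ∂(iidLaw μ)) ^ ((1 : ℝ) / ((p : ℝ) * (k : ℝ)))

/-- Exponential stability in `p`-th mean of the system driven by `μ`. -/
def IsMeanStable {n : ℕ} (p : ℕ) (μ : Measure (Mat n)) [IsProbabilityMeasure μ] : Prop :=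
  ∃ C : ℝ, 0 < C ∧ ∃ γ : ℝ, 0 ≤ γ ∧ γ < 1 ∧ ∀ (x₀ : Vec n) (k : ℕ),
    Integrable (fun A => ‖trajectory A x₀ k‖ ^ p) (iidLaw μ) ∧
      ∫ A, ‖trajectory A x₀ k‖ ^ p ∂(iidLaw μ) ≤ C * γ ^ (p * k) * ‖x₀‖ ^ p

/-- `V` is a stochastic Lyapunov function of degree `p` with growth rate `γ` for the system
driven by `μ`. -/
structure IsStochLyapunov {n : ℕ} (p : ℕ) (μ : Measure (Mat n)) (V : Vec n → ℝ) (γ : ℝ) :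
    Prop where
  bounds : ∃ C₁ C₂ : ℝ, 0 < C₁ ∧ 0 < C₂ ∧ ∀ x, C₁ * ‖x‖ ^ p ≤ V x ∧ V x ≤ C₂ * ‖x‖ ^ p
  rate_nonneg : 0 ≤ γ
  rate_lt_one : γ < 1
  integrable : ∀ x, Integrable (fun A => V (act A x)) μ
  decrease : ∀ x, ∫ A, V (act A x) ∂μ ≤ γ ^ p * V x

end

end SwitchedLinear

namespace SwitchedLinear

/-! ### Proper cones and the norms they induce -/

/-! Kronecker powers make the problem linear: `(A x)^{⊗p} = A^{⊗p} x^{⊗p}`, so means are governed by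
the single matrix `B = E[A^{⊗p}]` (`kronMean`). Independence gives `B ^ k = E[(A_{k-1} ⋯
A_0)^{⊗p}]`, whose entries are at most the `k`-th moment; by `exists_moment_le` this is far below `γ
^ (p k)` for some `k ≥ 1`.

The cone `K` lifts to the proper cone `kronCone p K`, preserved by `A^{⊗p}` for each `A` in the
support and hence by `B`. A functional `f₀` dominating the norm on this cone is therefore contracted
by some power of `B`, and a truncated Neumann series turns it into an `f` with `f (B z) ≤ γ ^ p * f
z` on the cone (`exists_lyapunov_functional`).

The norm is `N z = inf f (v + w)` over splits `z = v - w` in the cone (`coneSeminorm`). Since every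
`A^{⊗p}` preserves the cone, it carries splits to splits; averaging `f` over the images brings in
`B`, and the infimum over splits gives the decrease of `V`. The bounds on `V` follow from `‖x^{⊗p}‖
= ‖x‖ ^ p`. -/

lemma IsProperCone.zero_mem {n : ℕ} {K : Set (Vec n)} (hK : IsProperCone K) : (0 : Vec n) ∈ K := by
  obtain ⟨x, hx⟩ := hK.solid
  simpa using hK.smul_mem 0 le_rfl x (interior_subset hx)

lemma IsProperCone.add_mem {n : ℕ} {K : Set (Vec n)} (hK : IsProperCone K) {x y : Vec n}
    (hx : x ∈ K) (hy : y ∈ K) : x + y ∈ K := by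
  have h := hK.smul_mem 2 (by norm_num) _
    (hK.convex hx hy (a := 1 / 2) (b := 1 / 2) (by norm_num) (by norm_num) (by norm_num))
  simpa [smul_smul] using h

/-- A proper cone contains every point on which its dual cone is nonnegative. -/
lemma IsProperCone.mem_of_forall_dualCone {n : ℕ} {K : Set (Vec n)} (hK : IsProperCone K)
    {x : Vec n} (hx : ∀ f ∈ dualCone K, 0 ≤ inner ℝ f x) : x ∈ K := by
  by_contra hxK
  let C : ProperCone ℝ (Vec n) :=
    { carrier := K
      add_mem' := fun ha hb => hK.add_mem ha hb
      zero_mem' := hK.zero_mem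
      smul_mem' := fun c y hy => hK.smul_mem c c.2 y hy
      isClosed' := hK.isClosed }
  obtain ⟨f, hf, hfx⟩ := ProperCone.hyperplane_separation' C (x₀ := x) hxK
  have := hx f fun y hy => by rw [real_inner_comm]; exact hf y hy
  rw [real_inner_comm] at this
  linarith

/-- The dual of a proper cone spans the whole space. -/
lemma IsProperCone.span_dualCone {n : ℕ} {K : Set (Vec n)} (hK : IsProperCone K) :
    Submodule.span ℝ (dualCone K) = ⊤ := by
  -- If `x` is orthogonal to the dual cone, biduality puts both `x` and `-x` in `K`, and pointedness
  -- forces `x = 0`.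
  rw [← Submodule.orthogonal_eq_bot_iff, Submodule.eq_bot_iff]
  intro x hx
  have h : ∀ f ∈ dualCone K, inner ℝ f x = 0 := fun f hf => hx f (Submodule.subset_span hf)
  refine hK.pointed x (hK.mem_of_forall_dualCone fun f hf => (h f hf).ge)
    (hK.mem_of_forall_dualCone fun f hf => ?_)
  rw [inner_neg_right, h f hf, neg_zero]

/-- Some functional in the dual of a proper cone dominates a multiple of the norm on the cone. -/
lemma IsProperCone.exists_dualCone_lower_bound {n : ℕ} {K : Set (Vec n)} (hK : IsProperCone K) :
    ∃ f ∈ dualCone K, ∃ c : ℝ, 0 < c ∧ ∀ x ∈ K, c * ‖x‖ ≤ inner ℝ f x := by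
  -- The functional is the sum of a basis taken from the dual cone. On `K` its summands are
  -- nonnegative, so it dominates their maximum, which is a norm.
  let b := Module.Basis.ofSpan hK.span_dualCone.ge
  have hb : ∀ i, b i ∈ dualCone K := fun i =>
    Module.Basis.ofSpan_subset hK.span_dualCone.ge (mem_range_self i)
  have := FiniteDimensional.fintypeBasisIndex b
  let L : Vec n →ₗ[ℝ] (_ → ℝ) := LinearMap.pi fun i => innerₗ (Vec n) (b i)
  have hL : LinearMap.ker L = ⊥ := by
    rw [LinearMap.ker_eq_bot']
    intro x hx
    exact InnerProductSpace.ext_inner_left_basis (𝕜 := ℝ) b fun i => by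
      simpa [L] using congrFun hx i
  obtain ⟨C, hC0, hC⟩ := L.exists_antilipschitzWith hL
  have hC' : (0 : ℝ) < C := by exact_mod_cast hC0
  refine ⟨∑ i, b i, fun x hx => ?_, (C : ℝ)⁻¹, inv_pos.2 hC', fun x hx => ?_⟩
  · rw [sum_inner]
    exact Finset.sum_nonneg fun i _ => hb i x hx
  · have h1 : ‖x‖ ≤ C * ‖L x‖ := by simpa using hC.le_mul_dist x 0
    have h2 : ‖L x‖ ≤ inner ℝ (∑ i, b i) x := by
      rw [sum_inner]
      refine (pi_norm_le_iff_of_nonneg (Finset.sum_nonneg fun i _ => hb i x hx)).2 fun i => ?_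
      have h3 : L x i = inner ℝ (b i) x := rfl
      rw [h3, Real.norm_of_nonneg (hb i x hx)]
      exact Finset.single_le_sum (f := fun i => inner ℝ (b i) x) (fun i _ => hb i x hx)
        (Finset.mem_univ i)
    rw [inv_mul_le_iff₀ hC']
    exact h1.trans (mul_le_mul_of_nonneg_left h2 hC'.le)

/-- The values of `f` at `v + w`, for the decompositions `x = v - w` with `v, w ∈ K`. -/
def splitValues {n : ℕ} (K : Set (Vec n)) (f x : Vec n) : Set ℝ :=
  {r | ∃ v ∈ K, ∃ w ∈ K, x = v - w ∧ r = inner ℝ f (v + w)}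

lemma splitValues_nonneg {n : ℕ} {K : Set (Vec n)} (hK : IsProperCone K) {f : Vec n}
    (hf : f ∈ dualCone K) {x : Vec n} {r : ℝ} (hr : r ∈ splitValues K f x) : 0 ≤ r := by
  obtain ⟨v, hv, w, hw, -, rfl⟩ := hr
  exact hf _ (hK.add_mem hv hw)

lemma bddBelow_splitValues {n : ℕ} {K : Set (Vec n)} (hK : IsProperCone K) {f : Vec n}
    (hf : f ∈ dualCone K) (x : Vec n) : BddBelow (splitValues K f x) :=
  ⟨0, fun _ hr => splitValues_nonneg hK hf hr⟩

/-- A proper cone is generating. -/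
lemma IsProperCone.exists_sub {n : ℕ} {K : Set (Vec n)} (hK : IsProperCone K) (x : Vec n) :
    ∃ v ∈ K, ∃ w ∈ K, x = v - w := by
  obtain ⟨z, hz⟩ := hK.solid
  -- For an interior point `z` and small `t > 0`, `x = t⁻¹ (z + t x) - t⁻¹ z`.
  have h : ∀ᶠ t : ℝ in 𝓝 0, z + t • x ∈ K := by
    have : Tendsto (fun t : ℝ => z + t • x) (𝓝 0) (𝓝 z) := by
      have h0 : Continuous fun t : ℝ => z + t • x := by fun_prop
      simpa using h0.tendsto 0
    exact this.eventually (mem_interior_iff_mem_nhds.1 hz)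
  obtain ⟨ε, hε, h⟩ := Metric.eventually_nhds_iff.1 h
  have ht : z + (ε / 2) • x ∈ K := h (by simp [abs_of_pos hε]; linarith)
  have hpos : 0 < (ε / 2)⁻¹ := by positivity
  refine ⟨_, hK.smul_mem _ hpos.le _ ht, _, hK.smul_mem _ hpos.le _ (interior_subset hz), ?_⟩
  rw [← smul_sub, add_sub_cancel_left, smul_smul, inv_mul_cancel₀ (by positivity), one_smul]

lemma splitValues_nonempty {n : ℕ} {K : Set (Vec n)} (hK : IsProperCone K) (f x : Vec n) :
    (splitValues K f x).Nonempty := by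
  obtain ⟨v, hv, w, hw, h⟩ := hK.exists_sub x
  exact ⟨_, v, hv, w, hw, h, rfl⟩

lemma sInf_splitValues_le {n : ℕ} {K : Set (Vec n)} (hK : IsProperCone K) {f : Vec n}
    (hf : f ∈ dualCone K) {v w : Vec n} (hv : v ∈ K) (hw : w ∈ K) :
    sInf (splitValues K f (v - w)) ≤ inner ℝ f (v + w) :=
  csInf_le (bddBelow_splitValues hK hf _) ⟨v, hv, w, hw, rfl, rfl⟩

lemma exists_split_lt {n : ℕ} {K : Set (Vec n)} (hK : IsProperCone K) (f x : Vec n) {ε : ℝ}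
    (hε : 0 < ε) : ∃ v ∈ K, ∃ w ∈ K, x = v - w ∧
      inner ℝ f (v + w) < sInf (splitValues K f x) + ε := by
  obtain ⟨r, ⟨v, hv, w, hw, hx, rfl⟩, hr⟩ :=
    exists_lt_of_csInf_lt (splitValues_nonempty hK f x)
      (lt_add_of_pos_right (sInf (splitValues K f x)) hε)
  exact ⟨v, hv, w, hw, hx, hr⟩

lemma sInf_splitValues_smul_le {n : ℕ} {K : Set (Vec n)} (hK : IsProperCone K) {f : Vec n}
    (hf : f ∈ dualCone K) (a : ℝ) (x : Vec n) :
    sInf (splitValues K f (a • x)) ≤ ‖a‖ * sInf (splitValues K f x) := by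
  refine le_of_forall_pos_le_add fun δ hδ => ?_
  obtain ⟨v, hv, w, hw, rfl, h⟩ := exists_split_lt hK f x
    (ε := δ / (‖a‖ + 1)) (by positivity)
  have h1 : sInf (splitValues K f (a • (v - w))) ≤ ‖a‖ * inner ℝ f (v + w) := by
    rcases le_total 0 a with ha | ha
    · rw [Real.norm_of_nonneg ha, smul_sub, ← inner_smul_right, smul_add]
      exact sInf_splitValues_le hK hf (hK.smul_mem a ha v hv) (hK.smul_mem a ha w hw)
    -- A negative scalar exchanges the roles of `v` and `w`.
    · have ha' : 0 ≤ -a := neg_nonneg.2 ha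
      have h2 := sInf_splitValues_le hK hf (hK.smul_mem _ ha' w hw) (hK.smul_mem _ ha' v hv)
      rw [Real.norm_of_nonpos ha, ← inner_smul_right, smul_add, add_comm]
      have h3 : a • (v - w) = -a • w - -a • v := by module
      rwa [h3]
  have h4 : ‖a‖ * (δ / (‖a‖ + 1)) ≤ δ := by
    rw [← mul_div_assoc, div_le_iff₀ (by positivity)]
    nlinarith [norm_nonneg a]
  nlinarith [mul_le_mul_of_nonneg_left h.le (norm_nonneg a)]

/-- The seminorm `x ↦ inf {fᵀ (v + w) | v, w ∈ K, x = v - w}`. -/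
noncomputable def coneSeminorm {n : ℕ} {K : Set (Vec n)} (hK : IsProperCone K) {f : Vec n}
    (hf : f ∈ dualCone K) : Seminorm ℝ (Vec n) :=
  Seminorm.ofSMulLE (fun x => sInf (splitValues K f x))
    (le_antisymm (by simpa using sInf_splitValues_le hK hf hK.zero_mem hK.zero_mem)
      (Real.sInf_nonneg fun _ hr => splitValues_nonneg hK hf hr))
    (fun x y => by
      refine le_of_forall_pos_le_add fun δ hδ => ?_
      obtain ⟨v, hv, w, hw, rfl, h⟩ := exists_split_lt hK f x (half_pos hδ)
      obtain ⟨v', hv', w', hw', rfl, h'⟩ := exists_split_lt hK f y (half_pos hδ)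
      have h1 := sInf_splitValues_le hK hf (hK.add_mem hv hv') (hK.add_mem hw hw')
      rw [add_sub_add_comm, add_add_add_comm, inner_add_right] at h1
      linarith)
    (sInf_splitValues_smul_le hK hf)

lemma coneSeminorm_apply {n : ℕ} {K : Set (Vec n)} (hK : IsProperCone K) {f : Vec n}
    (hf : f ∈ dualCone K) (x : Vec n) : coneSeminorm hK hf x = sInf (splitValues K f x) := rfl

/-- The split `x = x - 0` is optimal: `f w ≥ 0` gives `f (v + w) ≥ f (v - w)`. -/
lemma coneSeminorm_of_mem {n : ℕ} {K : Set (Vec n)} (hK : IsProperCone K) {f : Vec n}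
    (hf : f ∈ dualCone K) {x : Vec n} (hx : x ∈ K) : coneSeminorm hK hf x = inner ℝ f x := by
  refine le_antisymm (by simpa [coneSeminorm_apply] using sInf_splitValues_le hK hf hx hK.zero_mem)
    (le_csInf (splitValues_nonempty hK f x) ?_)
  rintro r ⟨v, hv, w, hw, rfl, rfl⟩
  have := hf w hw
  rw [inner_sub_right, inner_add_right]
  linarith

lemma le_coneSeminorm {n : ℕ} {K : Set (Vec n)} (hK : IsProperCone K) {f : Vec n}
    (hf : f ∈ dualCone K) {c : ℝ} (hc : 0 ≤ c) (hfc : ∀ x ∈ K, c * ‖x‖ ≤ inner ℝ f x) (x : Vec n) :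
    c * ‖x‖ ≤ coneSeminorm hK hf x := by
  refine le_csInf (splitValues_nonempty hK f x) ?_
  rintro r ⟨v, hv, w, hw, rfl, rfl⟩
  rw [inner_add_right]
  nlinarith [hfc v hv, hfc w hw, mul_le_mul_of_nonneg_left (norm_sub_le v w) hc]

/-- If `f` dominates a multiple of the Euclidean norm on `K`, then `coneSeminorm` is a cone linear
absolute norm. -/
lemma isConeLinearAbsoluteNorm_coneSeminorm {n : ℕ} {K : Set (Vec n)} (hK : IsProperCone K)
    {f : Vec n} (hf : f ∈ dualCone K) {c : ℝ} (hc : 0 < c)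
    (hfc : ∀ x ∈ K, c * ‖x‖ ≤ inner ℝ f x) :
    IsConeLinearAbsoluteNorm (coneSeminorm hK hf) := by
  refine ⟨fun x hx => ?_, K, hK, ⟨f, hf, fun x hx => coneSeminorm_of_mem hK hf hx⟩, fun x => ?_⟩
  · have h := le_coneSeminorm hK hf hc.le hfc x
    rw [hx] at h
    exact norm_le_zero_iff.1 (nonpos_of_mul_nonpos_right h hc)
  · have h : {r : ℝ | ∃ v ∈ K, ∃ w ∈ K, x = v - w ∧ r = coneSeminorm hK hf (v + w)} =
        splitValues K f x := by
      ext r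
      constructor
      · rintro ⟨v, hv, w, hw, h, rfl⟩
        exact ⟨v, hv, w, hw, h, coneSeminorm_of_mem hK hf (hK.add_mem hv hw)⟩
      · rintro ⟨v, hv, w, hw, h, rfl⟩
        exact ⟨v, hv, w, hw, h, (coneSeminorm_of_mem hK hf (hK.add_mem hv hw)).symm⟩
    rw [h]
    exact isGLB_csInf (splitValues_nonempty hK f x) (bddBelow_splitValues hK hf x)

/-- A seminorm on `ℝⁿ` is bounded by a multiple of the Euclidean norm. -/
lemma exists_seminorm_le {n : ℕ} (N : Seminorm ℝ (Vec n)) :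
    ∃ C : ℝ, 0 < C ∧ ∀ x, N x ≤ C * ‖x‖ := by
  have hs : 0 ≤ ∑ i, N (EuclideanSpace.single i 1) := Finset.sum_nonneg fun i _ => apply_nonneg N _
  refine ⟨∑ i, N (EuclideanSpace.single i 1) + 1, by linarith, fun x => ?_⟩
  have h1 : x = ∑ i, x i • EuclideanSpace.single i (1 : ℝ) := by
    simpa using ((EuclideanSpace.basisFun (Fin n) ℝ).sum_repr x).symm
  have h2 : N x ≤ ∑ i, N (x i • EuclideanSpace.single i (1 : ℝ)) := by
    conv_lhs => rw [h1]
    exact Finset.le_sum_of_subadditive N (map_zero N).le (map_add_le_add N) _ _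
  refine h2.trans ?_
  rw [add_mul, Finset.sum_mul]
  refine le_add_of_le_of_nonneg (Finset.sum_le_sum fun i _ => ?_) (by positivity)
  rw [map_smul_eq_mul, mul_comm]
  exact mul_le_mul_of_nonneg_left (PiLp.norm_apply_le x i) (apply_nonneg N _)

lemma continuous_seminorm {n : ℕ} (N : Seminorm ℝ (Vec n)) : Continuous N := by
  obtain ⟨C, hC, h⟩ := exists_seminorm_le N
  refine Seminorm.continuous_of_le (q := C.toNNReal • normSeminorm ℝ (Vec n)) ?_ fun x => ?_
  · exact continuous_const.mul continuous_norm
  · simpa [NNReal.smul_def, hC.le] using h x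

/-! ### Kronecker products of families of vectors and Kronecker powers of matrices -/

/-- The Kronecker product `x₁ ⊗ ⋯ ⊗ x_p`, with the ordering of entries used by `kronPow`. -/
noncomputable def kronFam {n p : ℕ} (x : Fin p → Vec n) : Vec (n ^ p) :=
  WithLp.toLp 2 fun i => ∏ j : Fin p, x j (finFunctionFinEquiv.symm i j)

/-- The Kronecker power `A^{⊗p}`. -/
def kronMat {n : ℕ} (p : ℕ) (A : Mat n) : Mat (n ^ p) :=
  Matrix.of fun i i' =>
    ∏ j : Fin p, A (finFunctionFinEquiv.symm i j) (finFunctionFinEquiv.symm i' j)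

lemma kronPow_eq_kronFam {n : ℕ} (p : ℕ) (x : Vec n) : kronPow p x = kronFam fun _ => x := rfl

/-- Distributivity, with indices below `n ^ p` read as digit strings; the source of every product
formula for `kronFam` and `kronMat`. -/
lemma sum_prod_digits {n p : ℕ} (g : Fin p → Fin n → ℝ) :
    ∑ i : Fin (n ^ p), ∏ j, g j (finFunctionFinEquiv.symm i j) = ∏ j, ∑ k, g j k := by
  rw [Equiv.sum_comp finFunctionFinEquiv.symm fun x : Fin p → Fin n => ∏ j, g j (x j)]
  exact (Fintype.prod_sum g).symm

lemma inner_kronFam {n p : ℕ} (x y : Fin p → Vec n) :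
    inner ℝ (kronFam x) (kronFam y) = ∏ j, inner ℝ (x j) (y j) := by
  simp only [PiLp.inner_apply]
  rw [← sum_prod_digits]
  refine Finset.sum_congr rfl fun i _ => ?_
  simp [kronFam, Finset.prod_mul_distrib]

lemma norm_kronFam {n p : ℕ} (x : Fin p → Vec n) : ‖kronFam x‖ = ∏ j, ‖x j‖ := by
  have h := inner_kronFam x x
  simp only [real_inner_self_eq_norm_sq] at h
  rw [Finset.prod_pow] at h
  exact (pow_left_inj₀ (norm_nonneg _) (Finset.prod_nonneg fun _ _ => norm_nonneg _)
    two_ne_zero).1 h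

lemma norm_kronPow {n : ℕ} (p : ℕ) (x : Vec n) : ‖kronPow p x‖ = ‖x‖ ^ p := by
  simp [kronPow_eq_kronFam, norm_kronFam]

lemma act_apply {n : ℕ} (A : Mat n) (x : Vec n) (i : Fin n) : act A x i = ∑ j, A i j * x j := rfl

lemma act_mul {n : ℕ} (A B : Mat n) (x : Vec n) : act (A * B) x = act A (act B x) := by
  ext i
  simp only [act_apply, Matrix.mul_apply, Finset.sum_mul, Finset.mul_sum]
  rw [Finset.sum_comm]
  simp only [mul_assoc]

lemma act_one {n : ℕ} (x : Vec n) : act (1 : Mat n) x = x := by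
  ext i
  simp [act_apply, Matrix.one_apply]

lemma act_add {n : ℕ} (A : Mat n) (x y : Vec n) : act A (x + y) = act A x + act A y :=
  map_add _ x y

lemma act_sub {n : ℕ} (A : Mat n) (x y : Vec n) : act A (x - y) = act A x - act A y :=
  map_sub _ x y

lemma inner_act {n : ℕ} (A : Mat n) (x y : Vec n) :
    inner ℝ x (act A y) = ∑ i, ∑ j, x i * A i j * y j := by
  simp only [PiLp.inner_apply, act_apply]
  refine Finset.sum_congr rfl fun i _ => ?_
  simp [Finset.mul_sum, mul_comm, mul_assoc, mul_left_comm]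

lemma inner_act_transpose {n : ℕ} (A : Mat n) (x y : Vec n) :
    inner ℝ (act A.transpose x) y = inner ℝ x (act A y) := by
  rw [real_inner_comm, inner_act, inner_act, Finset.sum_comm]
  simp [mul_comm, mul_assoc, mul_left_comm]

lemma norm_act_le {n : ℕ} (A : Mat n) (x : Vec n) : ‖act A x‖ ≤ ‖A‖ * ‖x‖ :=
  A.l2_opNorm_mulVec x

lemma abs_entry_le {n : ℕ} (A : Mat n) (i j : Fin n) : |A i j| ≤ ‖A‖ := by
  have h := norm_act_le A (EuclideanSpace.single j 1)
  have h2 := PiLp.norm_apply_le (act A (EuclideanSpace.single j 1)) i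
  have h3 : act A (EuclideanSpace.single j 1) i = A i j := by
    simp [act_apply]
  rw [h3] at h2
  simpa using h2.trans h

lemma kronMat_apply {n : ℕ} (p : ℕ) (A : Mat n) (i i' : Fin (n ^ p)) : kronMat p A i i' =
    ∏ j : Fin p, A (finFunctionFinEquiv.symm i j) (finFunctionFinEquiv.symm i' j) := rfl

lemma act_kronMat_kronFam {n p : ℕ} (A : Mat n) (x : Fin p → Vec n) :
    act (kronMat p A) (kronFam x) = kronFam fun j => act A (x j) := by
  ext i
  rw [act_apply]
  simp only [kronFam, act_apply, kronMat_apply, ← Finset.prod_mul_distrib]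
  exact sum_prod_digits fun j k => A (finFunctionFinEquiv.symm i j) k * x j k

lemma act_kronMat_kronPow {n : ℕ} (p : ℕ) (A : Mat n) (x : Vec n) :
    act (kronMat p A) (kronPow p x) = kronPow p (act A x) :=
  act_kronMat_kronFam A _

lemma kronMat_mul {n : ℕ} (p : ℕ) (A B : Mat n) :
    kronMat p (A * B) = kronMat p A * kronMat p B := by
  ext i i'
  simp only [Matrix.mul_apply, kronMat_apply, ← Finset.prod_mul_distrib]
  exact (sum_prod_digits fun j k => A (finFunctionFinEquiv.symm i j) k *
    B k (finFunctionFinEquiv.symm i' j)).symm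

lemma kronMat_one {n : ℕ} (p : ℕ) : kronMat p (1 : Mat n) = 1 := by
  ext i i'
  simp only [kronMat_apply, Matrix.one_apply]
  split_ifs with h
  · subst h
    simp
  · obtain ⟨j, hj⟩ : ∃ j, finFunctionFinEquiv.symm i j ≠ finFunctionFinEquiv.symm i' j := by
      by_contra! hne
      exact h (finFunctionFinEquiv.symm.injective (funext hne))
    exact Finset.prod_eq_zero (Finset.mem_univ j) (by simp [hj])

lemma abs_kronMat_le {n : ℕ} (p : ℕ) (A : Mat n) (i j : Fin (n ^ p)) :
    |kronMat p A i j| ≤ ‖A‖ ^ p := by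
  rw [kronMat_apply, Finset.abs_prod]
  exact (Finset.prod_le_prod (fun _ _ => abs_nonneg _) fun _ _ => abs_entry_le A _ _).trans
    (by simp)

/-! ### The tensor power of a cone -/

/-- The cone of all `z ∈ ℝ^{n^p}` on which every Kronecker product of functionals in the dual
cone of `K` is nonnegative. -/
def kronCone {n : ℕ} (p : ℕ) (K : Set (Vec n)) : Set (Vec (n ^ p)) :=
  {z | ∀ f : Fin p → Vec n, (∀ j, f j ∈ dualCone K) → 0 ≤ inner ℝ (kronFam f) z}

/-- The functional `z` as a multilinear map of Kronecker factors. -/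
noncomputable def kronMultilinear {n p : ℕ} (z : Vec (n ^ p)) :
    MultilinearMap ℝ (fun _ : Fin p => Vec n) ℝ :=
  ∑ i, z i • (MultilinearMap.mkPiAlgebra ℝ (Fin p) ℝ).compLinearMap fun j =>
    (EuclideanSpace.proj (𝕜 := ℝ)
      (finFunctionFinEquiv.symm i j)).toLinearMap

lemma kronMultilinear_apply {n p : ℕ} (z : Vec (n ^ p)) (f : Fin p → Vec n) :
    kronMultilinear z f = inner ℝ (kronFam f) z := by
  simp [kronMultilinear, PiLp.inner_apply, kronFam]

lemma kronFam_single {n p : ℕ} (i : Fin (n ^ p)) :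
    kronFam (fun j => EuclideanSpace.single (finFunctionFinEquiv.symm i j) (1 : ℝ)) =
      EuclideanSpace.single i 1 := by
  ext i'
  have h := congrFun (congrFun (kronMat_one (n := n) p) i') i
  rw [kronMat_apply] at h
  simpa [kronFam, Matrix.one_apply, Pi.single_apply] using h

/-- The dual cone contains a basis, so the multilinear form attached to `z` vanishes identically;
its values at standard basis vectors are the coordinates of `z`. This makes the tensor cone pointed.
-/
lemma eq_zero_of_inner_kronFam {n p : ℕ} {K : Set (Vec n)} (hK : IsProperCone K)
    {z : Vec (n ^ p)} (hz : ∀ f : Fin p → Vec n, (∀ j, f j ∈ dualCone K) →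
      inner ℝ (kronFam f) z = 0) : z = 0 := by
  let b := Module.Basis.ofSpan hK.span_dualCone.ge
  have hb : ∀ i, b i ∈ dualCone K := fun i =>
    Module.Basis.ofSpan_subset hK.span_dualCone.ge (mem_range_self i)
  have h : kronMultilinear z = 0 := Module.Basis.ext_multilinear (fun _ => b) fun v => by
    rw [kronMultilinear_apply, hz _ fun j => hb (v j), _root_.zero_apply]
  ext i
  have h2 := kronMultilinear_apply z
    fun j => EuclideanSpace.single (finFunctionFinEquiv.symm i j) (1 : ℝ)
  rw [h, kronFam_single, EuclideanSpace.inner_single_left] at h2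
  simpa using h2.symm

/-- An interior point stays in `K` after a short step of fixed length along `-f / ‖f‖`, and `f` is
still nonnegative there. -/
lemma exists_inner_lower_bound_of_interior {n : ℕ} {K : Set (Vec n)} (hK : IsProperCone K) :
    ∃ x : Vec n, ∃ c : ℝ, 0 < c ∧ ∀ f ∈ dualCone K, c * ‖f‖ ≤ inner ℝ f x := by
  obtain ⟨x, hx⟩ := hK.solid
  obtain ⟨ε, hε, h⟩ := Metric.mem_nhds_iff.1 (mem_interior_iff_mem_nhds.1 hx)
  refine ⟨x, ε / 2, by positivity, fun f hf => ?_⟩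
  rcases eq_or_ne f 0 with rfl | hf0
  · simp
  have hn : 0 < ‖f‖ := norm_pos_iff.2 hf0
  have hmem : x - (ε / 2 * ‖f‖⁻¹) • f ∈ K := h (by
    rw [Metric.mem_ball, dist_eq_norm, sub_sub_cancel_left, norm_neg, norm_smul, norm_mul, norm_inv,
      norm_norm, mul_assoc, inv_mul_cancel₀ hn.ne', Real.norm_of_nonneg (by positivity)]
    linarith)
  have h1 := hf _ hmem
  rw [inner_sub_right, inner_smul_right, real_inner_self_eq_norm_sq] at h1
  have h2 : ε / 2 * ‖f‖⁻¹ * ‖f‖ ^ 2 = ε / 2 * ‖f‖ := by field_simp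
  linarith

lemma isProperCone_kronCone {n : ℕ} (p : ℕ) {K : Set (Vec n)} (hK : IsProperCone K) :
    IsProperCone (kronCone p K) where
  smul_mem c hc z hz f hf := by
    rw [inner_smul_right]
    exact mul_nonneg hc (hz f hf)
  isClosed := by
    have h : kronCone p K = ⋂ f : {f : Fin p → Vec n // ∀ j, f j ∈ dualCone K},
        {z | 0 ≤ inner ℝ (kronFam f.1) z} := by
      ext z
      simp [kronCone]
    rw [h]
    exact isClosed_iInter fun f => isClosed_le continuous_const (by fun_prop)
  convex z hz w hw a b ha hb _ f hf := by
    rw [inner_add_right, inner_smul_right, inner_smul_right]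
    exact add_nonneg (mul_nonneg ha (hz f hf)) (mul_nonneg hb (hw f hf))
  solid := by
    obtain ⟨x, c, hc, hx⟩ := exists_inner_lower_bound_of_interior hK
    -- At `x ⊗ ⋯ ⊗ x` a product functional is at least `c ^ p` times its own norm `∏ ‖f j‖`, so a
    -- perturbation shorter than `c ^ p` cannot make it negative.
    refine ⟨kronFam fun _ => x, mem_interior_iff_mem_nhds.2 (Metric.mem_nhds_iff.2
      ⟨c ^ p, by positivity, fun z hz f hf => ?_⟩)⟩
    have h1 : c ^ p * ∏ j, ‖f j‖ ≤ inner ℝ (kronFam f) (kronFam fun _ => x) := by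
      rw [inner_kronFam]
      calc c ^ p * ∏ j, ‖f j‖ = ∏ j, c * ‖f j‖ := by simp [Finset.prod_mul_distrib]
        _ ≤ _ := Finset.prod_le_prod (fun j _ => by positivity) fun j _ => hx _ (hf j)
    have h2 := real_inner_le_norm (kronFam f) ((kronFam fun _ => x) - z)
    rw [norm_kronFam, inner_sub_right, ← dist_eq_norm] at h2
    rw [Metric.mem_ball, dist_comm] at hz
    have h3 : (∏ j, ‖f j‖) * dist (kronFam fun _ => x) z ≤ (∏ j, ‖f j‖) * c ^ p :=
      mul_le_mul_of_nonneg_left hz.le (Finset.prod_nonneg fun _ _ => norm_nonneg _)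
    linarith
  pointed z hz hz' := eq_zero_of_inner_kronFam hK fun f hf => by
    have h := hz' f hf
    rw [inner_neg_right] at h
    linarith [hz f hf]

/-- By duality: the transpose of `A` preserves the dual cone of `K`, so the transpose of `A^{⊗p}`
permutes nothing but the factors' values, sending product functionals to product functionals. -/
lemma act_kronMat_mem_kronCone {n p : ℕ} {K : Set (Vec n)} {A : Mat n}
    (hA : ∀ x ∈ K, act A x ∈ K) {z : Vec (n ^ p)} (hz : z ∈ kronCone p K) :
    act (kronMat p A) z ∈ kronCone p K := by
  intro f hf
  have h : kronMat p A.transpose = (kronMat p A).transpose := rfl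
  rw [← inner_act_transpose, ← h, act_kronMat_kronFam]
  refine hz _ fun j x hx => ?_
  rw [inner_act_transpose]
  exact hf j _ (hA x hx)

/-! ### A multiplicative form of Fekete's lemma -/

/-- Blocks of length `q` are split off, each costing at most `d ^ q`; the remainder `r < q` is
absorbed by `M`, a sum over all remainders. -/
lemma exists_le_mul_pow_of_submultiplicative {c : ℕ → ℝ} (hc : ∀ k, 0 ≤ c k)
    (hmul : ∀ j k, c (j + k) ≤ c j * c k) {q : ℕ} (hq : 1 ≤ q) {d : ℝ} (hd : 0 < d)
    (hcq : c q ≤ d ^ q) : ∃ M : ℝ, 0 < M ∧ ∀ k, c k ≤ M * d ^ k := by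
  have hterm : ∀ r, 0 ≤ c r / d ^ r := fun r => div_nonneg (hc r) (by positivity)
  have hM : 0 < ∑ r ∈ Finset.range q, c r / d ^ r + 1 := by
    have := Finset.sum_nonneg fun r (_ : r ∈ Finset.range q) => hterm r
    linarith
  refine ⟨_, hM, fun k => ?_⟩
  induction k using Nat.strong_induction_on with
  | _ k ih =>
    rcases lt_or_ge k q with hk | hk
    · have h := Finset.single_le_sum (fun r _ => hterm r) (Finset.mem_range.2 hk)
      rw [← div_le_iff₀ (by positivity)]
      linarith
    · obtain ⟨l, rfl⟩ := Nat.exists_eq_add_of_le hk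
      calc c (q + l) ≤ c q * c l := hmul q l
        _ ≤ d ^ q * _ := mul_le_mul hcq (ih l (by omega)) (hc l) (by positivity)
        _ = _ := by ring

/-- The roots `c k ^ (1 / k)` of a nonnegative submultiplicative sequence converge. -/
lemma exists_tendsto_root_of_submultiplicative {c : ℕ → ℝ} (hc : ∀ k, 0 ≤ c k)
    (hmul : ∀ j k, c (j + k) ≤ c j * c k) :
    ∃ L : ℝ, Tendsto (fun k : ℕ => c k ^ ((1 : ℝ) / k)) atTop (𝓝 L) := by
  -- The limit is the infimum of the roots. Index `0` is left out: there `1 / 0 = 0` and the root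
  -- would be `1`.
  let S : Set ℝ := (fun k : ℕ => c k ^ ((1 : ℝ) / k)) '' Ici 1
  have hS0 : ∀ r ∈ S, 0 ≤ r := by
    rintro _ ⟨k, -, rfl⟩
    exact Real.rpow_nonneg (hc k) _
  have hSne : S.Nonempty := ⟨_, 1, le_refl 1, rfl⟩
  refine ⟨sInf S, tendsto_order.2 ⟨fun a ha => ?_, fun δ hδ => ?_⟩⟩
  · filter_upwards [eventually_ge_atTop 1] with k hk
    exact ha.trans_le (csInf_le ⟨0, hS0⟩ ⟨k, hk, rfl⟩)
  · obtain ⟨_, ⟨q, hq, rfl⟩, hlt⟩ := exists_lt_of_csInf_lt hSne hδ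
    simp only [mem_Ici] at hq
    obtain ⟨d, hd1, hd2⟩ := exists_between hlt
    have hd : 0 < d := (Real.rpow_nonneg (hc q) _).trans_lt hd1
    have hcq : c q ≤ d ^ q := by
      have h := pow_le_pow_left₀ (Real.rpow_nonneg (hc q) _) hd1.le q
      rwa [one_div, Real.rpow_inv_natCast_pow (hc q) (by omega)] at h
    obtain ⟨M, hM, h⟩ := exists_le_mul_pow_of_submultiplicative hc hmul hq hd hcq
    have hlim : Tendsto (fun k : ℕ => M ^ ((1 : ℝ) / k) * d) atTop (𝓝 d) := by
      have h1 : Tendsto (fun k : ℕ => M ^ ((1 : ℝ) / k)) atTop (𝓝 (M ^ (0 : ℝ))) :=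
        (Real.continuousAt_const_rpow hM.ne').tendsto.comp tendsto_one_div_atTop_nhds_zero_nat
      simpa using h1.mul_const d
    filter_upwards [hlim.eventually (gt_mem_nhds hd2), eventually_ge_atTop 1] with k hk hk1
    refine lt_of_le_of_lt ?_ hk
    calc c k ^ ((1 : ℝ) / k) ≤ (M * d ^ k) ^ ((1 : ℝ) / k) :=
          Real.rpow_le_rpow (hc k) (h k) (by positivity)
      _ = M ^ ((1 : ℝ) / k) * d := by
          rw [Real.mul_rpow hM.le (by positivity), one_div,
            Real.pow_rpow_inv_natCast hd.le (by omega)]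

/-! ### The law of a product of independent random matrices -/

lemma measurable_matProd {n : ℕ} (k : ℕ) : Measurable fun A : ℕ → Mat n => matProd A k := by
  induction k with
  | zero => exact measurable_const
  | succ k ih => exact (measurable_pi_apply k).mul ih

/-- The law of `A_{k-1} ⋯ A_0`. -/
noncomputable def prodLaw {n : ℕ} (μ : Measure (Mat n)) [IsProbabilityMeasure μ] (k : ℕ) :
    Measure (Mat n) :=
  (iidLaw μ).map fun A => matProd A k

instance instIsProbabilityMeasureIidLaw {n : ℕ} (μ : Measure (Mat n)) [IsProbabilityMeasure μ] :
    IsProbabilityMeasure (iidLaw μ) :=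
  inferInstanceAs (IsProbabilityMeasure (Measure.infinitePi fun _ : ℕ => μ))

instance instIsProbabilityMeasureProdLaw {n : ℕ} (μ : Measure (Mat n)) [IsProbabilityMeasure μ]
    (k : ℕ) : IsProbabilityMeasure (prodLaw μ k) :=
  Measure.isProbabilityMeasure_map (measurable_matProd k).aemeasurable

lemma matProd_congr {n : ℕ} {A B : ℕ → Mat n} {k : ℕ} (h : ∀ i < k, A i = B i) :
    matProd A k = matProd B k := by
  induction k with
  | zero => rfl
  | succ k ih =>
    simp only [matProd]
    rw [h k (Nat.lt_succ_self k), ih fun i hi => h i (hi.trans (Nat.lt_succ_self k))]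

lemma indepFun_eval_matProd {n : ℕ} (μ : Measure (Mat n)) [IsProbabilityMeasure μ] (k : ℕ) :
    ProbabilityTheory.IndepFun (fun A : ℕ → Mat n => A k) (fun A => matProd A k) (iidLaw μ) := by
  have hind : ProbabilityTheory.iIndepFun (fun (i : ℕ) (A : ℕ → Mat n) => A i) (iidLaw μ) :=
    ProbabilityTheory.iIndepFun_infinitePi (X := fun _ A => A) fun _ => measurable_id
  have h := hind.indepFun_finset {k} (Finset.range k) (by simp) fun i => measurable_pi_apply i
  -- The product uses only the coordinates below `k`; the others are filled with `1`.
  let g : ((i : Finset.range k) → Mat n) → Mat n := fun t =>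
    matProd (fun i => if hi : i ∈ Finset.range k then t ⟨i, hi⟩ else 1) k
  have hg : Measurable g := by
    refine (measurable_matProd k).comp (measurable_pi_lambda _ fun i => ?_)
    by_cases hi : i ∈ Finset.range k
    · simpa only [hi, dite_true] using measurable_pi_apply _
    · simpa only [hi, dite_false] using measurable_const
  have hφ : Measurable fun t : ((i : ({k} : Finset ℕ)) → Mat n) =>
      t ⟨k, Finset.mem_singleton_self k⟩ := measurable_pi_apply _
  have h2 := h.comp hφ hg
  refine h2.congr (ae_of_all _ fun A => rfl) (ae_of_all _ fun A => ?_)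
  exact matProd_congr fun i hi => by simp [hi]

lemma prodLaw_zero {n : ℕ} (μ : Measure (Mat n)) [IsProbabilityMeasure μ] :
    prodLaw μ 0 = Measure.dirac 1 := by
  simp [prodLaw, matProd]

lemma prodLaw_succ {n : ℕ} (μ : Measure (Mat n)) [IsProbabilityMeasure μ] (k : ℕ) :
    prodLaw μ (k + 1) = (μ.mconv (prodLaw μ k)) := by
  have h := (ProbabilityTheory.indepFun_iff_map_prod_eq_prod_map_map
    (measurable_pi_apply k).aemeasurable (measurable_matProd k).aemeasurable).1
      (indepFun_eval_matProd μ k)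
  have h1 : (iidLaw μ).map (fun A => A k) = μ := Measure.infinitePi_map_eval (fun _ => μ) k
  rw [h1] at h
  rw [Measure.mconv, prodLaw, prodLaw, ← h, Measure.map_map measurable_mul
    ((measurable_pi_apply k).prodMk (measurable_matProd k))]
  rfl

/-- Associativity of convolution takes the place of shift invariance; submultiplicativity of the
moments rests on this. -/
lemma prodLaw_add {n : ℕ} (μ : Measure (Mat n)) [IsProbabilityMeasure μ] (j k : ℕ) :
    prodLaw μ (j + k) = (prodLaw μ j).mconv (prodLaw μ k) := by
  induction j with
  | zero => rw [prodLaw_zero, Measure.dirac_one_mconv, zero_add]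
  | succ j ih => rw [Nat.succ_add, prodLaw_succ, ih, prodLaw_succ, Measure.mconv_assoc]

lemma ae_norm_le_of_isBounded_support {n : ℕ} {μ : Measure (Mat n)}
    (hbdd : Bornology.IsBounded μ.support) : ∃ R : ℝ, ∀ᵐ A ∂μ, ‖A‖ ≤ R := by
  obtain ⟨R, hR⟩ := hbdd.exists_norm_le
  refine ⟨R, ?_⟩
  filter_upwards [Measure.support_mem_ae (μ := μ)] with A hA
  exact hR A hA

lemma ae_norm_le_prodLaw {n : ℕ} {μ : Measure (Mat n)} [IsProbabilityMeasure μ]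
    (hbdd : Bornology.IsBounded μ.support) (k : ℕ) : ∃ R : ℝ, ∀ᵐ A ∂(prodLaw μ k), ‖A‖ ≤ R := by
  induction k with
  | zero =>
    refine ⟨‖(1 : Mat n)‖, ?_⟩
    rw [prodLaw_zero, ae_dirac_eq]
    exact Filter.eventually_pure.2 le_rfl
  | succ k ih =>
    obtain ⟨R, hR⟩ := ae_norm_le_of_isBounded_support hbdd
    obtain ⟨R', hR'⟩ := ih
    refine ⟨R * R', ?_⟩
    rw [prodLaw_succ, Measure.mconv, ae_map_iff measurable_mul.aemeasurable
      (measurableSet_le measurable_norm measurable_const)]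
    filter_upwards [Measure.quasiMeasurePreserving_fst.ae hR,
      Measure.quasiMeasurePreserving_snd.ae hR'] with x h1 h2
    exact (norm_mul_le _ _).trans (mul_le_mul h1 h2 (norm_nonneg _) ((norm_nonneg _).trans h1))

lemma integrable_of_norm_le_pow {n : ℕ} {ν : Measure (Mat n)} [IsFiniteMeasure ν]
    (hν : ∃ R : ℝ, ∀ᵐ A ∂ν, ‖A‖ ≤ R) {g : Mat n → ℝ} (hg : Continuous g) {C : ℝ} (hC : 0 ≤ C)
    {p : ℕ} (hle : ∀ A, |g A| ≤ C * ‖A‖ ^ p) : Integrable g ν := by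
  obtain ⟨R, hR⟩ := hν
  refine Integrable.of_bound hg.measurable.aestronglyMeasurable (C * R ^ p) ?_
  filter_upwards [hR] with A hA
  exact (hle A).trans (mul_le_mul_of_nonneg_left (pow_le_pow_left₀ (norm_nonneg _) hA p) hC)

/-- The moment `E ‖A_{k-1} ⋯ A_0‖^p`. -/
noncomputable def moment {n : ℕ} (p : ℕ) (μ : Measure (Mat n)) [IsProbabilityMeasure μ] (k : ℕ) :
    ℝ :=
  ∫ P, ‖P‖ ^ p ∂(prodLaw μ k)

lemma moment_eq {n : ℕ} (p : ℕ) (μ : Measure (Mat n)) [IsProbabilityMeasure μ] (k : ℕ) :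
    moment p μ k = ∫ A, ‖matProd A k‖ ^ p ∂(iidLaw μ) := by
  rw [moment, prodLaw, integral_map (measurable_matProd k).aemeasurable]
  exact (measurable_norm.pow_const p).aestronglyMeasurable

lemma moment_nonneg {n : ℕ} (p : ℕ) (μ : Measure (Mat n)) [IsProbabilityMeasure μ] (k : ℕ) :
    0 ≤ moment p μ k :=
  integral_nonneg fun _ => by positivity

lemma integrable_norm_pow_prodLaw {n : ℕ} (p : ℕ) {μ : Measure (Mat n)} [IsProbabilityMeasure μ]
    (hbdd : Bornology.IsBounded μ.support) (k : ℕ) :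
    Integrable (fun P => ‖P‖ ^ p) (prodLaw μ k) :=
  integrable_of_norm_le_pow (ae_norm_le_prodLaw hbdd k) (continuous_norm.pow p) zero_le_one
    (p := p) fun A => by rw [one_mul, abs_of_nonneg (by positivity)]

lemma moment_add_le {n : ℕ} (p : ℕ) {μ : Measure (Mat n)} [IsProbabilityMeasure μ]
    (hbdd : Bornology.IsBounded μ.support) (j k : ℕ) :
    moment p μ (j + k) ≤ moment p μ j * moment p μ k := by
  have hj := integrable_norm_pow_prodLaw p hbdd j
  have hk := integrable_norm_pow_prodLaw p hbdd k
  rw [moment, prodLaw_add, Measure.mconv, integral_map measurable_mul.aemeasurable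
    (measurable_norm.pow_const p).aestronglyMeasurable, moment, moment, ← integral_prod_mul]
  refine integral_mono_of_nonneg (ae_of_all _ fun _ => by positivity) (hj.mul_prod hk)
    (ae_of_all _ fun x => ?_)
  simpa only [mul_pow] using pow_le_pow_left₀ (norm_nonneg _) (norm_mul_le x.1 x.2) p

/-- Fekete's lemma, applied to the `p`-th roots of the moments, shows that the `limUnder` in
`pRadius` is a genuine limit. -/
lemma tendsto_moment_root {n p : ℕ} {μ : Measure (Mat n)} [IsProbabilityMeasure μ]
    (hbdd : Bornology.IsBounded μ.support) :
    Tendsto (fun k : ℕ => moment p μ k ^ ((1 : ℝ) / (p * k))) atTop (𝓝 (pRadius p μ)) := by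
  have h : ∃ L : ℝ, Tendsto (fun k : ℕ => moment p μ k ^ ((1 : ℝ) / (p * k))) atTop (𝓝 L) := by
    obtain ⟨L, hL⟩ := exists_tendsto_root_of_submultiplicative
      (c := fun k => moment p μ k ^ ((1 : ℝ) / p))
      (fun k => Real.rpow_nonneg (moment_nonneg p μ k) _) fun j k => by
        rw [← Real.mul_rpow (moment_nonneg p μ j) (moment_nonneg p μ k)]
        exact Real.rpow_le_rpow (moment_nonneg p μ _) (moment_add_le p hbdd j k) (by positivity)
    refine ⟨L, hL.congr fun k => ?_⟩
    rw [← Real.rpow_mul (moment_nonneg p μ k), one_div_mul_one_div]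
  have h2 := tendsto_nhds_limUnder h
  simpa only [pRadius, moment_eq] using h2

lemma pRadius_nonneg {n p : ℕ} {μ : Measure (Mat n)} [IsProbabilityMeasure μ]
    (hbdd : Bornology.IsBounded μ.support) : 0 ≤ pRadius p μ :=
  ge_of_tendsto' (tendsto_moment_root hbdd) fun k => Real.rpow_nonneg (moment_nonneg p μ k) _

/-- Moments are negligible with respect to `γ ^ (p k)` if `γ` exceeds the `p`-radius. -/
lemma exists_moment_le {n p : ℕ} (hp : 1 ≤ p) {μ : Measure (Mat n)} [IsProbabilityMeasure μ]
    (hbdd : Bornology.IsBounded μ.support) {γ : ℝ} (hγ : pRadius p μ < γ) {ε : ℝ} (hε : 0 < ε) :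
    ∃ k, k ≠ 0 ∧ moment p μ k ≤ ε * (γ ^ p) ^ k := by
  -- Moments are eventually below `d ^ (p k)`, and the gap `d < γ` makes `(d ^ p / γ ^ p) ^ k`
  -- smaller than any `ε`.
  obtain ⟨d, hd1, hd2⟩ := exists_between hγ
  have hd : 0 < d := (pRadius_nonneg hbdd).trans_lt hd1
  have hlt : d ^ p < γ ^ p := pow_lt_pow_left₀ hd2 hd.le (by omega)
  have hγp : 0 < γ ^ p := (pow_pos hd p).trans hlt
  have hlim := tendsto_pow_atTop_nhds_zero_of_lt_one (r := d ^ p / γ ^ p) (by positivity)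
    ((div_lt_one hγp).2 hlt)
  obtain ⟨k, hk, hk2, hk1⟩ := (((tendsto_moment_root hbdd).eventually (gt_mem_nhds hd1)).and
    ((hlim.eventually (gt_mem_nhds hε)).and (eventually_ge_atTop 1))).exists
  refine ⟨k, by omega, ?_⟩
  have h1 : moment p μ k ≤ (d ^ p) ^ k := by
    have h := pow_le_pow_left₀ (Real.rpow_nonneg (moment_nonneg p μ k) _) hk.le (p * k)
    rwa [one_div, ← Nat.cast_mul, Real.rpow_inv_natCast_pow (moment_nonneg p μ k)
      (Nat.mul_ne_zero (by omega) (by omega)), pow_mul] at h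
  rw [div_pow, div_lt_iff₀ (by positivity)] at hk2
  exact h1.trans hk2.le

/-! ### The mean of the Kronecker power -/

lemma continuous_kronMat_apply {n : ℕ} (p : ℕ) (i j : Fin (n ^ p)) :
    Continuous fun A : Mat n => kronMat p A i j := by
  simp only [kronMat_apply]
  exact continuous_finsetProd _ fun l _ => continuous_id.matrix_elem _ _

lemma integrable_kronMat {n : ℕ} (p : ℕ) {ν : Measure (Mat n)} [IsFiniteMeasure ν]
    (hν : ∃ R : ℝ, ∀ᵐ A ∂ν, ‖A‖ ≤ R) (i j : Fin (n ^ p)) :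
    Integrable (fun A => kronMat p A i j) ν :=
  integrable_of_norm_le_pow hν (continuous_kronMat_apply p i j) zero_le_one (p := p) fun A => by
    rw [one_mul]
    exact abs_kronMat_le p A i j

/-- The matrix `E[A^{⊗p}]`. -/
noncomputable def kronMean {n : ℕ} (p : ℕ) (μ : Measure (Mat n)) : Mat (n ^ p) :=
  Matrix.of fun i j => ∫ A, kronMat p A i j ∂μ

lemma kronMean_apply {n : ℕ} (p : ℕ) (μ : Measure (Mat n)) (i j : Fin (n ^ p)) :
    kronMean p μ i j = ∫ A, kronMat p A i j ∂μ := rfl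

/-- Multiplicativity of `A ↦ A^{⊗p}` combined with Fubini. -/
lemma kronMean_mconv {n : ℕ} (p : ℕ) {μ ν : Measure (Mat n)} [IsFiniteMeasure μ]
    [IsFiniteMeasure ν] (hμ : ∃ R : ℝ, ∀ᵐ A ∂μ, ‖A‖ ≤ R) (hν : ∃ R : ℝ, ∀ᵐ A ∂ν, ‖A‖ ≤ R) :
    kronMean p (μ.mconv ν) = kronMean p μ * kronMean p ν := by
  ext i j
  rw [Matrix.mul_apply, kronMean_apply, Measure.mconv, integral_map measurable_mul.aemeasurable
    (continuous_kronMat_apply p i j).measurable.aestronglyMeasurable]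
  simp only [kronMat_mul, Matrix.mul_apply, kronMean_apply]
  rw [integral_finsetSum _ fun l _ =>
    (integrable_kronMat p hμ i l).mul_prod (integrable_kronMat p hν l j)]
  exact Finset.sum_congr rfl fun l _ =>
    integral_prod_mul (fun A => kronMat p A i l) fun A => kronMat p A l j

lemma kronMean_pow {n : ℕ} (p : ℕ) {μ : Measure (Mat n)} [IsProbabilityMeasure μ]
    (hbdd : Bornology.IsBounded μ.support) (k : ℕ) :
    kronMean p μ ^ k = kronMean p (prodLaw μ k) := by
  induction k with
  | zero =>
    ext i j
    rw [kronMean_apply, prodLaw_zero, integral_dirac, kronMat_one, pow_zero]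
  | succ k ih =>
    rw [prodLaw_succ, kronMean_mconv p (ae_norm_le_of_isBounded_support hbdd)
      (ae_norm_le_prodLaw hbdd k), pow_succ', ih]

lemma abs_kronMean_pow_le {n : ℕ} (p : ℕ) {μ : Measure (Mat n)} [IsProbabilityMeasure μ]
    (hbdd : Bornology.IsBounded μ.support) (k : ℕ) (i j : Fin (n ^ p)) :
    |(kronMean p μ ^ k) i j| ≤ moment p μ k := by
  rw [kronMean_pow p hbdd, kronMean_apply]
  refine (abs_integral_le_integral_abs).trans ?_
  exact integral_mono (integrable_kronMat p (ae_norm_le_prodLaw hbdd k) i j).abs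
    (integrable_norm_pow_prodLaw p hbdd k) fun A => abs_kronMat_le p A i j

lemma integral_inner_act_kronMat {n p : ℕ} {μ : Measure (Mat n)} [IsProbabilityMeasure μ]
    (hbdd : Bornology.IsBounded μ.support) (f z : Vec (n ^ p)) :
    Integrable (fun A => inner ℝ f (act (kronMat p A) z)) μ ∧
      ∫ A, inner ℝ f (act (kronMat p A) z) ∂μ = inner ℝ f (act (kronMean p μ) z) := by
  have hint : ∀ i j, Integrable (fun A => f i * kronMat p A i j * z j) μ := fun i j =>
    ((integrable_kronMat p (ae_norm_le_of_isBounded_support hbdd) i j).const_mul _).mul_const _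
  simp only [inner_act]
  refine ⟨integrable_finsetSum _ fun i _ => integrable_finsetSum _ fun j _ => hint i j, ?_⟩
  rw [integral_finsetSum _ fun i _ => integrable_finsetSum _ fun j _ => hint i j]
  refine Finset.sum_congr rfl fun i _ => ?_
  rw [integral_finsetSum _ fun j _ => hint i j]
  refine Finset.sum_congr rfl fun j _ => ?_
  rw [integral_mul_const, integral_const_mul, kronMean_apply]

/-! ### The Lyapunov functional -/

/-- The mean of the Kronecker power leaves the tensor cone invariant. -/
lemma act_kronMean_mem {n p : ℕ} {μ : Measure (Mat n)} [IsProbabilityMeasure μ]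
    (hbdd : Bornology.IsBounded μ.support) {K : Set (Vec n)} (hK : IsProperCone K)
    (hinv : LeavesInvariant μ.support K) {z : Vec (n ^ p)} (hz : z ∈ kronCone p K) :
    act (kronMean p μ) z ∈ kronCone p K := by
  -- By biduality it suffices to test functionals, for which the claim is that a nonnegative
  -- function has nonnegative integral.
  refine (isProperCone_kronCone p hK).mem_of_forall_dualCone fun f hf => ?_
  rw [← (integral_inner_act_kronMat hbdd f z).2]
  refine integral_nonneg_of_ae ?_
  filter_upwards [Measure.support_mem_ae (μ := μ)] with A hA
  exact hf _ (act_kronMat_mem_kronCone (hinv A hA) hz)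

lemma inner_act_le {m : ℕ} {B : Mat m} {a : ℝ} (ha : 0 ≤ a) (hB : ∀ i j, |B i j| ≤ a)
    (x y : Vec m) : inner ℝ x (act B y) ≤ (m : ℝ) ^ 2 * a * ‖x‖ * ‖y‖ := by
  rw [inner_act]
  have h : ∀ i ∈ Finset.univ, ∀ j ∈ Finset.univ, x i * B i j * y j ≤ a * ‖x‖ * ‖y‖ := by
    intro i _ j _
    refine (le_abs_self _).trans ?_
    rw [abs_mul, abs_mul, mul_comm |x i|]
    exact mul_le_mul (mul_le_mul (hB i j) (PiLp.norm_apply_le x i) (abs_nonneg _) ha)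
      (PiLp.norm_apply_le y j) (abs_nonneg _) (by positivity)
  refine (Finset.sum_le_sum fun i hi => Finset.sum_le_sum (h i hi)).trans (le_of_eq ?_)
  simp only [Finset.sum_const, Finset.card_univ, Fintype.card_fin, nsmul_eq_mul]
  ring

/-- If `B` leaves the cone `K` invariant and one of its powers contracts the functional `f₀` by the
factor `g ^ k`, then some functional above `f₀` is contracted by the factor `g`. -/
lemma exists_contracted_functional {m : ℕ} {K : Set (Vec m)} {B : Mat m}
    (hB : ∀ z ∈ K, act B z ∈ K) {f₀ : Vec m} (hf₀ : f₀ ∈ dualCone K) {g : ℝ} (hg : 0 < g) {k : ℕ}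
    (hk : ∀ z ∈ K, inner ℝ f₀ (act (B ^ k) z) ≤ g ^ k * inner ℝ f₀ z)
    (hk0 : k ≠ 0) :
    ∃ f ∈ dualCone K, (∀ z ∈ K, inner ℝ f₀ z ≤ inner ℝ f z) ∧
      ∀ z ∈ K, inner ℝ f (act B z) ≤ g * inner ℝ f z := by
  have hpow : ∀ j, ∀ z ∈ K, act (B ^ j) z ∈ K := by
    intro j
    induction j with
    | zero => intro z hz; rwa [pow_zero, act_one]
    | succ j ih => intro z hz; rw [pow_succ, act_mul]; exact ih _ (hB z hz)
  -- Truncated Neumann series. Shifting the index gives `g⁻¹ f (B z) = f z - f₀ z + g⁻ᵏ f₀ (Bᵏ z)`,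
  -- and `hk` says that the last two terms add up to at most `0`.
  let f : Vec m := ∑ j ∈ Finset.range k, (g⁻¹) ^ j • act (B ^ j).transpose f₀
  have hf : ∀ z, inner ℝ f z = ∑ j ∈ Finset.range k, (g⁻¹) ^ j * inner ℝ f₀ (act (B ^ j) z) := by
    intro z
    simp only [f, sum_inner, real_inner_smul_left, inner_act_transpose]
  have hterm : ∀ z ∈ K, ∀ j, 0 ≤ (g⁻¹) ^ j * inner ℝ f₀ (act (B ^ j) z) := fun z hz j =>
    mul_nonneg (by positivity) (hf₀ _ (hpow j z hz))
  refine ⟨f, fun z hz => ?_, fun z hz => ?_, fun z hz => ?_⟩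
  · rw [hf]
    exact Finset.sum_nonneg fun j _ => hterm z hz j
  · rw [hf]
    have h := Finset.single_le_sum (fun j _ => hterm z hz j)
      (Finset.mem_range.2 (Nat.pos_of_ne_zero hk0))
    simpa [act_one] using h
  · have h1 : inner ℝ f (act B z) =
        g * ∑ j ∈ Finset.range k, (g⁻¹) ^ (j + 1) * inner ℝ f₀ (act (B ^ (j + 1)) z) := by
      rw [hf, Finset.mul_sum]
      refine Finset.sum_congr rfl fun j _ => ?_
      rw [← act_mul, ← pow_succ, pow_succ g⁻¹]
      field_simp
    have h2 := Finset.sum_range_succ' (fun j => (g⁻¹) ^ j * inner ℝ f₀ (act (B ^ j) z)) k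
    rw [Finset.sum_range_succ, ← hf] at h2
    have h3 : (g⁻¹) ^ k * inner ℝ f₀ (act (B ^ k) z) ≤ inner ℝ f₀ z := by
      rw [inv_pow, inv_mul_le_iff₀ (by positivity)]
      exact hk z hz
    simp only [pow_zero, act_one, one_mul] at h2
    rw [h1]
    exact mul_le_mul_of_nonneg_left (by linarith) hg.le

/-- In the tensor cone there is a functional, positive off the origin, that `E[A^{⊗p}]` contracts by
the factor `γ ^ p`. -/
lemma exists_lyapunov_functional {n p : ℕ} (hp : 1 ≤ p) {μ : Measure (Mat n)}
    [IsProbabilityMeasure μ] (hbdd : Bornology.IsBounded μ.support) {K : Set (Vec n)}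
    (hK : IsProperCone K) (hinv : LeavesInvariant μ.support K) {γ : ℝ} (hγ : pRadius p μ < γ) :
    ∃ f ∈ dualCone (kronCone p K), ∃ c : ℝ, 0 < c ∧
      (∀ z ∈ kronCone p K, c * ‖z‖ ≤ inner ℝ f z) ∧
      ∀ z ∈ kronCone p K, inner ℝ f (act (kronMean p μ) z) ≤ γ ^ p * inner ℝ f z := by
  obtain ⟨f₀, hf₀, c, hc, hfc⟩ := (isProperCone_kronCone p hK).exists_dualCone_lower_bound
  have hγ0 : 0 < γ := (pRadius_nonneg hbdd).trans_lt hγ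
  -- The constant of `inner_act_le`, increased by `1` to be positive. A moment below `(c / M) γ ^ (p
  -- k)` then gives `f₀ (Bᵏ z) ≤ γ ^ (p k) c ‖z‖`.
  let M : ℝ := ((n ^ p : ℕ) : ℝ) ^ 2 * ‖f₀‖ + 1
  have hM : 0 < M := by positivity
  obtain ⟨k, hk0, hk⟩ := exists_moment_le hp hbdd hγ (ε := c / M) (by positivity)
  obtain ⟨f, hf, hle, hcon⟩ := exists_contracted_functional (K := kronCone p K)
    (fun z hz => act_kronMean_mem hbdd hK hinv hz) hf₀ (pow_pos hγ0 p) (k := k) (fun z hz => by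
      have h1 := inner_act_le (moment_nonneg p μ k) (abs_kronMean_pow_le p hbdd k) f₀ z
      have h2 : moment p μ k * M ≤ c * (γ ^ p) ^ k := by
        rwa [div_mul_eq_mul_div, le_div_iff₀ hM] at hk
      calc _ ≤ _ := h1
        _ ≤ moment p μ k * M * ‖z‖ := by
          have h3 : 0 ≤ moment p μ k * ‖z‖ := mul_nonneg (moment_nonneg p μ k) (norm_nonneg z)
          simp only [M]
          linarith
        _ ≤ c * (γ ^ p) ^ k * ‖z‖ := mul_le_mul_of_nonneg_right h2 (norm_nonneg z)
        _ = (γ ^ p) ^ k * (c * ‖z‖) := by ring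
        _ ≤ _ := mul_le_mul_of_nonneg_left (hfc z hz) (by positivity)) hk0
  exact ⟨f, hf, c, hc, fun z hz => (hfc z hz).trans (hle z hz), hcon⟩

lemma continuous_act_left {n : ℕ} (x : Vec n) : Continuous fun A : Mat n => act A x := by
  have h : Continuous fun (A : Mat n) (i : Fin n) => ∑ j, A i j * x j :=
    continuous_pi fun i => continuous_finsetSum _ fun j _ =>
      (continuous_id.matrix_elem i j).mul_const (x j)
  exact (PiLp.continuous_toLp 2 _).comp h

lemma continuous_kronPow {n : ℕ} (p : ℕ) : Continuous fun x : Vec n => kronPow p x := by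
  have h : Continuous fun (x : Vec n) (i : Fin (n ^ p)) =>
      ∏ j : Fin p, x (finFunctionFinEquiv.symm i j) :=
    continuous_pi fun i => continuous_finsetProd _ fun j _ =>
      (EuclideanSpace.proj (𝕜 := ℝ) (finFunctionFinEquiv.symm i j)).continuous
  exact (PiLp.continuous_toLp 2 _).comp h

lemma integrable_seminorm_kronPow {n p : ℕ} {μ : Measure (Mat n)} [IsProbabilityMeasure μ]
    (hbdd : Bornology.IsBounded μ.support) (N : Seminorm ℝ (Vec (n ^ p))) (x : Vec n) :
    Integrable (fun A => N (kronPow p (act A x))) μ := by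
  obtain ⟨C, hC, hN⟩ := exists_seminorm_le N
  refine integrable_of_norm_le_pow (ae_norm_le_of_isBounded_support hbdd)
    ((continuous_seminorm N).comp ((continuous_kronPow p).comp (continuous_act_left x)))
    (C := C * ‖x‖ ^ p) (by positivity) (p := p) fun A => ?_
  rw [abs_of_nonneg (apply_nonneg N _)]
  refine (hN _).trans ?_
  rw [norm_kronPow, mul_assoc, mul_comm (‖x‖ ^ p), ← mul_pow]
  exact mul_le_mul_of_nonneg_left (pow_le_pow_left₀ (norm_nonneg _) (norm_act_le A x) p) hC.le

end SwitchedLinear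

open SwitchedLinear in
theorem mainTheorem4 (n p : ℕ) (hp : 1 ≤ p)
    (μ : Measure (SwitchedLinear.Mat n)) [IsProbabilityMeasure μ]
    (hbdd : Bornology.IsBounded μ.support)
    (hstable : SwitchedLinear.IsMeanStable p μ)
    (hcone : ∃ K : Set (SwitchedLinear.Vec n), SwitchedLinear.IsProperCone K ∧
      SwitchedLinear.LeavesInvariant μ.support K)
    (γ : ℝ) (hγ : γ ∈ Set.Ioo (SwitchedLinear.pRadius p μ) 1) :
    ∃ N : Seminorm ℝ (SwitchedLinear.Vec (n ^ p)),
      SwitchedLinear.IsConeLinearAbsoluteNorm N ∧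
      SwitchedLinear.IsStochLyapunov p μ
        (fun x => N (SwitchedLinear.kronPow p x)) γ := by
  obtain ⟨K, hK, hinv⟩ := hcone
  obtain ⟨f, hf, c, hc, hfc, hcon⟩ := exists_lyapunov_functional hp hbdd hK hinv hγ.1
  have hK' := isProperCone_kronCone p hK
  have hγ0 : 0 ≤ γ := (pRadius_nonneg hbdd).trans hγ.1.le
  refine ⟨coneSeminorm hK' hf, isConeLinearAbsoluteNorm_coneSeminorm hK' hf hc hfc, ?_⟩
  refine ⟨?_, hγ0, hγ.2, integrable_seminorm_kronPow hbdd _, fun x => ?_⟩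
  · obtain ⟨C, hC, hN⟩ := exists_seminorm_le (coneSeminorm hK' hf)
    refine ⟨c, C, hc, hC, fun x => ?_⟩
    rw [← norm_kronPow]
    exact ⟨le_coneSeminorm hK' hf hc.le hfc _, hN _⟩
  · have hγp : 0 ≤ γ ^ p := pow_nonneg hγ0 p
    refine le_of_forall_pos_le_add fun ε hε => ?_
    -- One nearly optimal split serves all `A` at once: its image under `A^{⊗p}` is again a split,
    -- so the upper bound is linear in `A^{⊗p}` and can be averaged.
    obtain ⟨v, hv, w, hw, hx, hlt⟩ := exists_split_lt hK' f (kronPow p x)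
      (ε := ε / (γ ^ p + 1)) (by positivity)
    obtain ⟨hint, hmean⟩ := integral_inner_act_kronMat hbdd f (v + w)
    calc ∫ A, coneSeminorm hK' hf (kronPow p (act A x)) ∂μ
        ≤ ∫ A, inner ℝ f (act (kronMat p A) (v + w)) ∂μ := by
          refine integral_mono_ae (integrable_seminorm_kronPow hbdd _ x) hint ?_
          filter_upwards [Measure.support_mem_ae (μ := μ)] with A hA
          rw [← act_kronMat_kronPow, hx, act_sub, act_add]
          exact sInf_splitValues_le hK' hf (act_kronMat_mem_kronCone (hinv A hA) hv)
            (act_kronMat_mem_kronCone (hinv A hA) hw)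
      _ = inner ℝ f (act (kronMean p μ) (v + w)) := hmean
      _ ≤ γ ^ p * inner ℝ f (v + w) := hcon _ (hK'.add_mem hv hw)
      _ ≤ γ ^ p * (coneSeminorm hK' hf (kronPow p x) + ε / (γ ^ p + 1)) :=
          mul_le_mul_of_nonneg_left hlt.le hγp
      _ ≤ γ ^ p * coneSeminorm hK' hf (kronPow p x) + ε := by
          have h : γ ^ p * (ε / (γ ^ p + 1)) ≤ ε := by
            rw [← mul_div_assoc, div_le_iff₀ (by positivity)]
            nlinarith
          linarith
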